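/- **Setting.** Fix a first-order alphabet of function and predicate symbols containing a unary predicate $\mathtt{error}$; equality $=$ is an additional built-in predicate. A *program* $P$ is a finite set of predicate definitions $(p(V_1,\dots,V_n),\ \exists W[C_1\lor\dots\lor C_k])$, $k>0$, at most one for each predicate $p\neq{=}$, where the $V_i$ are distinct variables, each $C_j$ is a conjunction of literals (atoms, including equations, or negated atoms), and $W$ is the set of the remaining (local) variables. The truth values are $\mathbf u=\emptyset$, $\mathbf t=\{\mathrm{true}\}$, $\mathbf f=\{\mathrm{false}\}$, $\mathbf i=\{\mathrm{true},\mathrm{false}\}$; the information order $\sqsubseteq$ is inclusion, with meet $\sqcap$. An interpretation $I$ maps each ground atom to a truth value, with $s=t$ mapped to $\mathbf t$ if $s,t$ are identical and to $\mathbf f$ otherwise. It makes an atom $A$ true (false) iff $\mathrm{true}\in I(A)$ ($\mathrm{false}\in I(A)$); negation swaps true and false; a conjunction is made true iff all its literals are, and false iff some literal is; a disjunction is made true iff some disjunct is, and false iff all are; $\exists W[D]$ is made true iff some ground instance of $D$ is, and false iff all ground instances are. $I(B)$ is the set of classical values that $I$ gives to $B$ in this way. $I$ is a $\sqsupseteq^{\mathbf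 4}$-*model* of $P$ if $I(B)\sqsubseteq I(H)$ for every instance $(H,B)$ of a definition of $P$ in which the head variables are replaced by ground terms. A ground atom *succeeds* if it has a successful SLDNF derivation from $P$ (for some selection of literals, negative literals being selected only when ground; a call to a predicate other than $=$ without a definition, such as the primitive $\mathtt{error}$, neither succeeds nor fails), or, in the idealised operational semantics, if it has the value $\mathbf t$ in the $\sqsubseteq$-least fixed point of the immediate consequence operator $\Phi_P$, where $\Phi_P(I)(H)=I(B)$ for each such instance $(H,B)$, and $\Phi_P(I)(H)=\mathbf u$ for atoms $H$ of predicates other than $=$ without a definition. Let any notion of well-typedness of the arguments of ground atoms be given. A *mode* $m$ of a predicate $p$ assigns "input" or "output" to each argument position of $p$. The mode interpretation for $m$ gives an atom $p(t_1,\dots,t_n)$ the value $\mathbf u$ if $p=\mathtt{error}$; otherwise $\mathbf t$ if all arguments are well typed, $\mathbf i$ if some input argument is ill typed, and $\mathbf f$ if all input arguments are well typed but some output argument is ill typed. A *moded program* is a program with a set of modes for each predicate other than $=$; its *mode interpretation* gives an atom of $p$ the meet $\sqcap$, over the modes $m$ of $p$, of its values in the mode interpretations for $m$. **Proposition.** Let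 $M$ be the mode interpretation of a moded program $P$, and suppose that $M$ is a $\sqsupseteq^{\mathbf 4}$-model of $P$. Let $A$ be a ground atom of a predicate other than $=$ which succeeds, and suppose that for some mode of its predicate all input arguments of $A$ are well typed. Then all arguments of $A$ are well typed. -/

import Mathlib

universe u v

noncomputable section

namespace LogicProg

/-! ### Syntax -/

/-- A predicate symbol (other than the built-in equality) together with its arity.  The alphabet is
a first-order language: its function symbols build the terms, its relation symbols are the
predicate symbols. -/
abbrev Pred (L : FirstOrder.Language.{u, v}) : Type v := Σ n : ℕ, L.Relations n

/-- Atoms `p(t₁, …, tₙ)` over the variables `α`, for a predicate `p` other than equality. -/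
structure PredAtom (L : FirstOrder.Language.{u, v}) (α : Type) where
  pred : Pred L
  args : Fin pred.1 → L.Term α

/-- Ground atoms `p(t₁, …, tₙ)`, for a predicate `p` other than equality. -/
abbrev GroundAtom (L : FirstOrder.Language.{u, v}) := PredAtom L Empty

/-- Atoms: either `p(t₁, …, tₙ)`, or an equality `s = t`. -/
inductive Atom (L : FirstOrder.Language.{u, v}) (α : Type) where
  | rel (A : PredAtom L α) : Atom L α
  | eq (s t : L.Term α) : Atom L α

/-- Literals: atoms and negated atoms. -/
inductive Literal (L : FirstOrder.Language.{u, v}) (α : Type) where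
  | pos (A : Atom L α) : Literal L α
  | neg (A : Atom L α) : Literal L α

/-- Conjunctions of literals (also used as goals). -/
abbrev Conj (L : FirstOrder.Language.{u, v}) (α : Type) := List (Literal L α)

section Substitution

variable {L : FirstOrder.Language.{u, v}} {α β : Type}

def PredAtom.subst (σ : α → L.Term β) (A : PredAtom L α) : PredAtom L β :=
  ⟨A.pred, fun i => (A.args i).subst σ⟩

def Atom.subst (σ : α → L.Term β) : Atom L α → Atom L β
  | .rel A => .rel (A.subst σ)
  | .eq s t => .eq (s.subst σ) (t.subst σ)

def Literal.subst (σ : α → L.Term β) : Literal L α → Literal L β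
  | .pos A => .pos (A.subst σ)
  | .neg A => .neg (A.subst σ)

def Conj.subst (σ : α → L.Term β) (C : Conj L α) : Conj L β :=
  C.map (Literal.subst σ)

end Substitution

/-- A predicate definition `(p(V₁, …, Vₙ), ∃ W [C₁ ∨ ⋯ ∨ Cₖ])` with `k > 0`.  The distinct head
variables are indexed by `Fin n` (left summand), the local variables `W` by `Fin locals` (right
summand); all variables of the body are of one of these two kinds. -/
structure PredDef (L : FirstOrder.Language.{u, v}) where
  pred : Pred L
  locals : ℕ
  disjuncts : List (Conj L (Fin pred.1 ⊕ Fin locals))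
  disjuncts_ne_nil : disjuncts ≠ []

/-- A program: a finite set of predicate definitions, at most one for each predicate. -/
structure Program (L : FirstOrder.Language.{u, v}) where
  defs : Set (PredDef L)
  finite_defs : defs.Finite
  unique_defs : ∀ d ∈ defs, ∀ d' ∈ defs, d.pred = d'.pred → d = d'

/-! ### Four-valued interpretations -/

/-- The four truth values, as sets of classical truth values.  The information ordering `⊑` is
inclusion, that is, `≤` on `Set Bool`, and its meet `⊓` is intersection. -/
abbrev Four := Set Bool

namespace Four

/-- undefined -/
def u : Four := ∅
/-- true -/
def t : Four := {true}
/-- false -/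
def f : Four := {false}
/-- inadmissible (both true and false) -/
def i : Four := {true, false}

/-- The truth value of a formula that is made true iff `T` and made false iff `F`. -/
def ofProps (T F : Prop) : Four := {b | (b = true ∧ T) ∨ (b = false ∧ F)}

end Four

/-- Four-valued interpretations, with the pointwise information ordering.  Only the values of the
atoms of predicates other than equality are recorded: those of ground equalities are fixed, see
`Interp.AtomTrue` and `Interp.AtomFalse`. -/
abbrev Interp (L : FirstOrder.Language.{u, v}) := GroundAtom L → Four

section Semantics

variable {L : FirstOrder.Language.{u, v}}

def Interp.AtomTrue (I : Interp L) : Atom L Empty → Prop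
  | .rel A => true ∈ I A
  | .eq s t => s = t

def Interp.AtomFalse (I : Interp L) : Atom L Empty → Prop
  | .rel A => false ∈ I A
  | .eq s t => s ≠ t

def Interp.MakesTrue (I : Interp L) : Literal L Empty → Prop
  | .pos A => I.AtomTrue A
  | .neg A => I.AtomFalse A

def Interp.MakesFalse (I : Interp L) : Literal L Empty → Prop
  | .pos A => I.AtomFalse A
  | .neg A => I.AtomTrue A

def Interp.ConjTrue (I : Interp L) (C : Conj L Empty) : Prop := ∀ l ∈ C, I.MakesTrue l

def Interp.ConjFalse (I : Interp L) (C : Conj L Empty) : Prop := ∃ l ∈ C, I.MakesFalse l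

/-- `I` makes true the body `∃ W [D]` of the head grounding of `d` with head `p(ts)`: some ground
instance of `D` is made true. -/
def Interp.BodyTrue (I : Interp L) (d : PredDef L) (ts : Fin d.pred.1 → L.Term Empty) : Prop :=
  ∃ w : Fin d.locals → L.Term Empty, ∃ C ∈ d.disjuncts, I.ConjTrue (C.subst (Sum.elim ts w))

/-- `I` makes false the body `∃ W [D]` of the head grounding of `d` with head `p(ts)`: all ground
instances of `D` are made false. -/
def Interp.BodyFalse (I : Interp L) (d : PredDef L) (ts : Fin d.pred.1 → L.Term Empty) : Prop :=
  ∀ w : Fin d.locals → L.Term Empty, ∀ C ∈ d.disjuncts, I.ConjFalse (C.subst (Sum.elim ts w))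

/-- The truth value in `I` of the body of the head grounding of `d` with head `p(ts)`. -/
def Interp.bodyValue (I : Interp L) (d : PredDef L) (ts : Fin d.pred.1 → L.Term Empty) : Four :=
  Four.ofProps (I.BodyTrue d ts) (I.BodyFalse d ts)

/-- `I` is an `R`-model of `P`: for each head grounding `(H, B)` of each predicate definition in
`P`, the relation `R (I H) (I B)` holds. -/
def IsModel (R : Four → Four → Prop) (P : Program L) (I : Interp L) : Prop :=
  ∀ d ∈ P.defs, ∀ ts : Fin d.pred.1 → L.Term Empty, R (I ⟨d.pred, ts⟩) (I.bodyValue d ts)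

theorem Interp.makesTrue_mono {I J : Interp L} (h : I ≤ J) :
    ∀ l : Literal L Empty, I.MakesTrue l → J.MakesTrue l
  | .pos (.rel A), hl => h A hl
  | .pos (.eq _ _), hl => hl
  | .neg (.rel A), hl => h A hl
  | .neg (.eq _ _), hl => hl

theorem Interp.makesFalse_mono {I J : Interp L} (h : I ≤ J) :
    ∀ l : Literal L Empty, I.MakesFalse l → J.MakesFalse l
  | .pos (.rel A), hl => h A hl
  | .pos (.eq _ _), hl => hl
  | .neg (.rel A), hl => h A hl
  | .neg (.eq _ _), hl => hl

theorem Interp.bodyValue_mono {I J : Interp L} (h : I ≤ J) (d : PredDef L)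
    (ts : Fin d.pred.1 → L.Term Empty) : I.bodyValue d ts ≤ J.bodyValue d ts := by
  rintro b (⟨rfl, w, C, hC, hT⟩ | ⟨rfl, hF⟩)
  · exact Or.inl ⟨rfl, w, C, hC, fun l hl => Interp.makesTrue_mono h l (hT l hl)⟩
  · refine Or.inr ⟨rfl, fun w C hC => ?_⟩
    obtain ⟨l, hl, hlF⟩ := hF w C hC
    exact ⟨l, hl, Interp.makesFalse_mono h l hlF⟩

/-- The immediate consequence operator `Φ_P`: the new value of a ground atom `H` is the old value
of `B`, where `(H, B)` is the head grounding of a definition in `P`.  Atoms of predicates without a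
definition (such as the primitive `error/1`) become neither true nor false. -/
def Program.phi (P : Program L) : Interp L →o Interp L where
  toFun I A := {b | ∃ d ∈ P.defs, ∃ ts : Fin d.pred.1 → L.Term Empty,
    A = ⟨d.pred, ts⟩ ∧ b ∈ I.bodyValue d ts}
  monotone' := by
    rintro I J h A b ⟨d, hd, ts, hA, hb⟩
    exact ⟨d, hd, ts, hA, Interp.bodyValue_mono h d ts hb⟩

end Semantics

/-! ### SLDNF resolution -/

section SLDNF

variable {L : FirstOrder.Language.{u, v}}

def Atom.vars : Atom L ℕ → Set ℕ
  | .rel A => {x | ∃ i, x ∈ (A.args i).varFinset}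
  | .eq s t => {x | x ∈ s.varFinset ∨ x ∈ t.varFinset}

def Literal.vars : Literal L ℕ → Set ℕ
  | .pos A => A.vars
  | .neg A => A.vars

/-- The set of variables that occur in a goal. -/
def Conj.vars (G : Conj L ℕ) : Set ℕ := {x | ∃ l ∈ G, x ∈ l.vars}

/-- `σ` is a most general unifier of `s` and `t`. -/
def IsMGU (σ : ℕ → L.Term ℕ) (s t : L.Term ℕ) : Prop :=
  s.subst σ = t.subst σ ∧
    ∀ τ : ℕ → L.Term ℕ, s.subst τ = t.subst τ → ∃ δ : ℕ → L.Term ℕ, ∀ x, τ x = (σ x).subst δ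

/-- A ground atom, seen as an atom that may contain variables. -/
def Atom.ofGround (A : Atom L Empty) : Atom L ℕ := A.subst Empty.elim

/-- Given terms `ts` for the head variables and names `ρ` for the local variables, the
corresponding instance of a disjunct of a definition. -/
def PredDef.resolvent {d : PredDef L} (ts : Fin d.pred.1 → L.Term ℕ) (ρ : Fin d.locals → ℕ)
    (C : Conj L (Fin d.pred.1 ⊕ Fin d.locals)) : Conj L ℕ :=
  C.subst (Sum.elim ts fun j => FirstOrder.Language.Term.var (ρ j))

mutual

/-- The goal `G` has a successful SLDNF derivation from `P`, for some choice of the selected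
literals.  Negative literals are selected only when they are ground. -/
inductive Program.GoalSucceeds (P : Program L) : Conj L ℕ → Prop
  | nil : P.GoalSucceeds []
  /-- A selected atom is replaced by a disjunct of (a fresh variant of) its definition. -/
  | rel (G₁ G₂ : Conj L ℕ) (d : PredDef L) (hd : d ∈ P.defs) (ts : Fin d.pred.1 → L.Term ℕ)
      (ρ : Fin d.locals → ℕ) (hρ : Function.Injective ρ)
      (hfresh : ∀ j, ρ j ∉ Conj.vars (G₁ ++ .pos (.rel ⟨d.pred, ts⟩) :: G₂))
      (C : Conj L (Fin d.pred.1 ⊕ Fin d.locals)) (hC : C ∈ d.disjuncts)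
      (h : P.GoalSucceeds (G₁ ++ PredDef.resolvent ts ρ C ++ G₂)) :
      P.GoalSucceeds (G₁ ++ .pos (.rel ⟨d.pred, ts⟩) :: G₂)
  /-- A selected equation is solved by unification. -/
  | eq (G₁ G₂ : Conj L ℕ) (s t : L.Term ℕ) (σ : ℕ → L.Term ℕ) (hσ : IsMGU σ s t)
      (h : P.GoalSucceeds (Conj.subst σ (G₁ ++ G₂))) :
      P.GoalSucceeds (G₁ ++ .pos (.eq s t) :: G₂)
  /-- A selected ground negative literal succeeds if its atom finitely fails. -/
  | neg (G₁ G₂ : Conj L ℕ) (A : Atom L Empty) (hA : P.GoalFails [.pos A.ofGround])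
      (h : P.GoalSucceeds (G₁ ++ G₂)) :
      P.GoalSucceeds (G₁ ++ .neg A.ofGround :: G₂)

/-- The goal `G` has a finitely failed SLDNF tree from `P`, for some choice of the selected
literals.  A call to a predicate without a definition (such as the primitive `error/1`) is an
error, hence neither success nor failure. -/
inductive Program.GoalFails (P : Program L) : Conj L ℕ → Prop
  | rel (G₁ G₂ : Conj L ℕ) (d : PredDef L) (hd : d ∈ P.defs) (ts : Fin d.pred.1 → L.Term ℕ)
      (ρ : Fin d.locals → ℕ) (hρ : Function.Injective ρ)
      (hfresh : ∀ j, ρ j ∉ Conj.vars (G₁ ++ .pos (.rel ⟨d.pred, ts⟩) :: G₂))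
      (h : ∀ C ∈ d.disjuncts, P.GoalFails (G₁ ++ PredDef.resolvent ts ρ C ++ G₂)) :
      P.GoalFails (G₁ ++ .pos (.rel ⟨d.pred, ts⟩) :: G₂)
  | eq (G₁ G₂ : Conj L ℕ) (s t : L.Term ℕ) (σ : ℕ → L.Term ℕ) (hσ : IsMGU σ s t)
      (h : P.GoalFails (Conj.subst σ (G₁ ++ G₂))) :
      P.GoalFails (G₁ ++ .pos (.eq s t) :: G₂)
  | eq_not_unifiable (G₁ G₂ : Conj L ℕ) (s t : L.Term ℕ)
      (h : ∀ σ : ℕ → L.Term ℕ, s.subst σ ≠ t.subst σ) :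
      P.GoalFails (G₁ ++ .pos (.eq s t) :: G₂)
  | neg (G₁ G₂ : Conj L ℕ) (A : Atom L Empty) (hA : P.GoalFails [.pos A.ofGround])
      (h : P.GoalFails (G₁ ++ G₂)) :
      P.GoalFails (G₁ ++ .neg A.ofGround :: G₂)
  | neg_of_succeeds (G₁ G₂ : Conj L ℕ) (A : Atom L Empty)
      (hA : P.GoalSucceeds [.pos A.ofGround]) :
      P.GoalFails (G₁ ++ .neg A.ofGround :: G₂)

end

/-- The ground atom `A` succeeds: it has a successful SLDNF derivation. -/
def Program.Succeeds (P : Program L) (A : GroundAtom L) : Prop :=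
  P.GoalSucceeds [.pos (Atom.ofGround (.rel A))]

/-- The ground atom `A` succeeds in the idealised operational semantics, in which the atoms that
succeed are those that have the value `t` in the least fixed point of `Φ_P`. -/
def Program.IdeallySucceeds (P : Program L) (A : GroundAtom L) : Prop :=
  OrderHom.lfp P.phi A = Four.t

end SLDNF

/-! ### Types and modes -/

inductive Direction where
  | input
  | output

/-- A mode for `p`: each argument position is an input or an output. -/
abbrev Mode {L : FirstOrder.Language.{u, v}} (p : Pred L) := Fin p.1 → Direction

/-- A notion of well-typedness: `T p ts i` says that the `i`-th argument of the ground atom `p(ts)`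
is well typed.  (It may, but need not, depend on the other arguments.) -/
abbrev Typing (L : FirstOrder.Language.{u, v}) :=
  ∀ p : Pred L, (Fin p.1 → L.Term Empty) → Fin p.1 → Prop

/-- A moded program: a program with a mode group, that is, a set of modes, for each predicate. -/
structure ModedProgram (L : FirstOrder.Language.{u, v}) where
  program : Program L
  modes : ∀ p : Pred L, Set (Mode p)

section Modes

variable {L : FirstOrder.Language.{u, v}}

open Classical in
/-- The value of the ground atom `p(ts)` in the mode interpretation for the single mode `m` of `p`,
where `error` is the predicate `error/1`. -/
def modeValue (error : L.Relations 1) (T : Typing L) (p : Pred L) (m : Mode p)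
    (ts : Fin p.1 → L.Term Empty) : Four :=
  if p = ⟨1, error⟩ then Four.u
  else if ∀ i, T p ts i then Four.t
  else if ∃ i, m i = Direction.input ∧ ¬ T p ts i then Four.i
  else Four.f

/-- The mode interpretation of a moded program: on the atoms of each predicate, the meet in the
information ordering of the mode interpretations for the modes in its mode group. -/
def ModedProgram.modeInterp (Q : ModedProgram L) (error : L.Relations 1) (T : Typing L) :
    Interp L :=
  fun A => ⨅ m ∈ Q.modes A.pred, modeValue error T A.pred m A.args

end Modes

end LogicProg

end

/-!
The `⊒`-models of `P` are the pre-fixed points of `Φ_P`, so they lie above its least fixed point.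
SLDNF resolution is sound for each of them: by a simultaneous induction on derivations and finitely
failed trees, a goal that succeeds has a ground instance that is made true, and all ground
instances of a goal that fails are made false. Hence a ground atom `A` that succeeds, in either
sense, is made true by the mode interpretation, and therefore by the larger interpretation for the
mode whose inputs are well typed in `A`. The only value of that interpretation that makes `A` true
without all arguments being well typed is `i`, which requires an ill-typed input.
-/

namespace LogicProg

section Substitution

variable {L : FirstOrder.Language.{u, v}} {α β γ : Type}

theorem term_subst_subst (t : L.Term α) (σ : α → L.Term β) (τ : β → L.Term γ) :
    (t.subst σ).subst τ = t.subst fun x => (σ x).subst τ := by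
  induction t with
  | var x => rfl
  | func f ts ih => simp only [FirstOrder.Language.Term.subst, ih]

theorem term_subst_congr [DecidableEq α] {σ τ : α → L.Term β} (t : L.Term α)
    (h : Set.EqOn σ τ t.varFinset) : t.subst σ = t.subst τ := by
  induction t with
  | var x => exact h (by simp [FirstOrder.Language.Term.varFinset])
  | func f ts ih =>
    simp only [FirstOrder.Language.Term.subst]
    congr 1
    funext i
    refine ih i fun x hx => h ?_
    exact Finset.mem_biUnion.2 ⟨i, Finset.mem_univ i, hx⟩

theorem term_subst_of_isEmpty [IsEmpty α] (t : L.Term α) (σ : α → L.Term α) : t.subst σ = t := by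
  induction t with
  | var x => exact isEmptyElim x
  | func f ts ih => simp only [FirstOrder.Language.Term.subst, ih]

theorem term_subst_subst_of_isEmpty [IsEmpty α] (t : L.Term α) (σ : α → L.Term β)
    (τ : β → L.Term α) : (t.subst σ).subst τ = t := by
  rw [term_subst_subst, term_subst_of_isEmpty]

theorem Atom.subst_subst (A : Atom L α) (σ : α → L.Term β) (τ : β → L.Term γ) :
    (A.subst σ).subst τ = A.subst fun x => (σ x).subst τ := by
  cases A <;> simp only [Atom.subst, PredAtom.subst, term_subst_subst]

theorem Atom.subst_ofGround (A : Atom L Empty) (σ : ℕ → L.Term Empty) :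
    A.ofGround.subst σ = A := by
  cases A <;> simp only [Atom.ofGround, Atom.subst, PredAtom.subst, term_subst_subst_of_isEmpty]

theorem Atom.subst_congr {σ τ : ℕ → L.Term β} (A : Atom L ℕ) (h : Set.EqOn σ τ A.vars) :
    A.subst σ = A.subst τ := by
  cases A with
  | rel A =>
    simp only [Atom.subst, PredAtom.subst]
    congr 2
    funext i
    exact term_subst_congr (A.args i) fun x hx => h ⟨i, hx⟩
  | eq s t =>
    simp only [Atom.subst]
    rw [term_subst_congr s fun x hx => h (Or.inl hx),
      term_subst_congr t fun x hx => h (Or.inr hx)]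

theorem Literal.subst_subst (l : Literal L α) (σ : α → L.Term β) (τ : β → L.Term γ) :
    (l.subst σ).subst τ = l.subst fun x => (σ x).subst τ := by
  cases l <;> simp only [Literal.subst, Atom.subst_subst]

theorem Literal.subst_congr {σ τ : ℕ → L.Term β} (l : Literal L ℕ) (h : Set.EqOn σ τ l.vars) :
    l.subst σ = l.subst τ := by
  cases l with
  | pos A => exact congrArg Literal.pos (A.subst_congr h)
  | neg A => exact congrArg Literal.neg (A.subst_congr h)

theorem Conj.subst_subst (C : Conj L α) (σ : α → L.Term β) (τ : β → L.Term γ) :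
    Conj.subst τ (Conj.subst σ C) = Conj.subst (fun x => (σ x).subst τ) C := by
  simp only [Conj.subst, List.map_map]
  exact List.map_congr_left fun l _ => l.subst_subst σ τ

theorem Conj.subst_congr {σ τ : ℕ → L.Term β} (G : Conj L ℕ) (h : Set.EqOn σ τ (Conj.vars G)) :
    Conj.subst σ G = Conj.subst τ G :=
  List.map_congr_left fun l hl => l.subst_congr fun _ hx => h ⟨l, hl, hx⟩

theorem Conj.vars_middle (G₁ G₂ : Conj L ℕ) (l : Literal L ℕ) :
    Conj.vars (G₁ ++ l :: G₂) = l.vars ∪ Conj.vars (G₁ ++ G₂) := by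
  ext x
  simp only [Conj.vars, List.mem_append, List.mem_cons, Set.mem_union, Set.mem_ofPred_eq]
  grind

theorem PredDef.subst_resolvent {d : PredDef L} (ts : Fin d.pred.1 → L.Term ℕ)
    (ρ : Fin d.locals → ℕ) (C : Conj L (Fin d.pred.1 ⊕ Fin d.locals)) (σ : ℕ → L.Term β) :
    Conj.subst σ (PredDef.resolvent ts ρ C) =
      C.subst (Sum.elim (fun i => (ts i).subst σ) (σ ∘ ρ)) := by
  rw [PredDef.resolvent, Conj.subst_subst]
  congr 1
  funext x
  cases x <;> rfl

/- Freshness of the local variables lets a substitution be redefined on them alone. -/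
theorem PredDef.exists_subst_resolvent_eq {d : PredDef L} {G₁ G₂ : Conj L ℕ}
    {ts : Fin d.pred.1 → L.Term ℕ} {ρ : Fin d.locals → ℕ} (hρ : Function.Injective ρ)
    (hfresh : ∀ j, ρ j ∉ Conj.vars (G₁ ++ .pos (.rel ⟨d.pred, ts⟩) :: G₂))
    (σ : ℕ → L.Term β) (w : Fin d.locals → L.Term β) :
    ∃ τ : ℕ → L.Term β, Conj.subst τ (G₁ ++ G₂) = Conj.subst σ (G₁ ++ G₂) ∧
      ∀ C, Conj.subst τ (PredDef.resolvent ts ρ C) =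
        C.subst (Sum.elim (fun i => (ts i).subst σ) w) := by
  let τ := Function.extend ρ w σ
  have hlocals : τ ∘ ρ = w := Function.extend_comp hρ w σ
  have hagree : Set.EqOn τ σ (Conj.vars (G₁ ++ .pos (.rel ⟨d.pred, ts⟩) :: G₂)) := fun x hx =>
    Function.extend_apply' w σ x fun ⟨j, hj⟩ => hfresh j (hj ▸ hx)
  rw [Conj.vars_middle, Set.eqOn_union] at hagree
  obtain ⟨hhead, hrest⟩ := hagree
  have hargs : (fun i => (ts i).subst τ) = fun i => (ts i).subst σ :=
    funext fun i => term_subst_congr (ts i) fun x hx => hhead ⟨i, hx⟩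
  exact ⟨τ, Conj.subst_congr _ hrest, fun C => by rw [subst_resolvent, hargs, hlocals]⟩

theorem IsMGU.exists_ground_factor [Nonempty (L.Term Empty)] {σ : ℕ → L.Term ℕ} {s t : L.Term ℕ}
    (hσ : IsMGU σ s t) {τ : ℕ → L.Term Empty} (hτ : s.subst τ = t.subst τ) :
    ∃ δ : ℕ → L.Term Empty, τ = fun x => (σ x).subst δ := by
  let ι : Empty → L.Term ℕ := Empty.elim
  obtain ⟨δ, hδ⟩ := hσ.2 (fun x => (τ x).subst ι) (by simp only [← term_subst_subst, hτ])
  obtain ⟨c⟩ := ‹Nonempty (L.Term Empty)›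
  refine ⟨fun y => (δ y).subst fun _ => c, funext fun x => ?_⟩
  rw [← term_subst_subst, ← hδ x, term_subst_subst_of_isEmpty]

end Substitution

section Goals

variable {L : FirstOrder.Language.{u, v}} {I : Interp L}

theorem Interp.conjTrue_subst_splice {α : Type} {σ : α → L.Term Empty} {G₁ R G₂ : Conj L α} :
    I.ConjTrue (Conj.subst σ (G₁ ++ R ++ G₂)) ↔
      I.ConjTrue (Conj.subst σ R) ∧ I.ConjTrue (Conj.subst σ (G₁ ++ G₂)) := by
  simp only [Interp.ConjTrue, Conj.subst, List.map_append, List.forall_mem_append]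
  exact and_assoc.trans and_left_comm

theorem Interp.conjFalse_subst_splice {α : Type} {σ : α → L.Term Empty} {G₁ R G₂ : Conj L α} :
    I.ConjFalse (Conj.subst σ (G₁ ++ R ++ G₂)) ↔
      I.ConjFalse (Conj.subst σ R) ∨ I.ConjFalse (Conj.subst σ (G₁ ++ G₂)) := by
  simp only [Interp.ConjFalse, Conj.subst, List.map_append, List.mem_append, or_and_right,
    exists_or]
  exact or_assoc.trans or_left_comm

theorem Interp.conjTrue_subst_middle {α : Type} {σ : α → L.Term Empty} {G₁ G₂ : Conj L α}
    {l : Literal L α} :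
    I.ConjTrue (Conj.subst σ (G₁ ++ l :: G₂)) ↔
      I.MakesTrue (l.subst σ) ∧ I.ConjTrue (Conj.subst σ (G₁ ++ G₂)) := by
  rw [List.append_cons, conjTrue_subst_splice]
  simp only [Interp.ConjTrue, Conj.subst, List.map_singleton, List.forall_mem_singleton]

theorem Interp.conjFalse_subst_middle {α : Type} {σ : α → L.Term Empty} {G₁ G₂ : Conj L α}
    {l : Literal L α} :
    I.ConjFalse (Conj.subst σ (G₁ ++ l :: G₂)) ↔
      I.MakesFalse (l.subst σ) ∨ I.ConjFalse (Conj.subst σ (G₁ ++ G₂)) := by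
  rw [List.append_cons, conjFalse_subst_splice]
  simp only [Interp.ConjFalse, Conj.subst, List.map_singleton, List.mem_singleton,
    exists_eq_left]

/-- `I` makes true the existential closure of the goal `G`: some ground instance is made true. This
is the semantic counterpart of success. -/
def Interp.GoalTrue (I : Interp L) (G : Conj L ℕ) : Prop :=
  ∃ σ : ℕ → L.Term Empty, I.ConjTrue (Conj.subst σ G)

/-- `I` makes false the existential closure of the goal `G`: all ground instances are made false.
This is the semantic counterpart of finite failure. -/
def Interp.GoalFalse (I : Interp L) (G : Conj L ℕ) : Prop :=
  ∀ σ : ℕ → L.Term Empty, I.ConjFalse (Conj.subst σ G)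

theorem Interp.goalTrue_nil [Nonempty (L.Term Empty)] : I.GoalTrue [] :=
  ⟨Classical.arbitrary _, List.forall_mem_nil _⟩

theorem Interp.goalTrue_ofGround_iff [Nonempty (L.Term Empty)] {A : Atom L Empty} :
    I.GoalTrue [.pos A.ofGround] ↔ I.AtomTrue A := by
  simp [Interp.GoalTrue, Interp.ConjTrue, Conj.subst, Literal.subst, Interp.MakesTrue,
    Atom.subst_ofGround]

theorem Interp.goalFalse_ofGround_iff [Nonempty (L.Term Empty)] {A : Atom L Empty} :
    I.GoalFalse [.pos A.ofGround] ↔ I.AtomFalse A := by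
  simp [Interp.GoalFalse, Interp.ConjFalse, Conj.subst, Literal.subst, Interp.MakesFalse,
    Atom.subst_ofGround]

theorem Interp.GoalTrue.insert_eq {G₁ G₂ : Conj L ℕ} {s t : L.Term ℕ} {σ : ℕ → L.Term ℕ}
    (hσ : s.subst σ = t.subst σ) (h : I.GoalTrue (Conj.subst σ (G₁ ++ G₂))) :
    I.GoalTrue (G₁ ++ .pos (.eq s t) :: G₂) := by
  obtain ⟨δ, hδ⟩ := h
  rw [Conj.subst_subst] at hδ
  have hst : (s.subst fun x => (σ x).subst δ) = t.subst fun x => (σ x).subst δ := by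
    rw [← term_subst_subst, ← term_subst_subst, hσ]
  exact ⟨_, conjTrue_subst_middle.2 ⟨hst, hδ⟩⟩

theorem Interp.GoalFalse.insert_eq [Nonempty (L.Term Empty)] {G₁ G₂ : Conj L ℕ} {s t : L.Term ℕ}
    {σ : ℕ → L.Term ℕ} (hσ : IsMGU σ s t) (h : I.GoalFalse (Conj.subst σ (G₁ ++ G₂))) :
    I.GoalFalse (G₁ ++ .pos (.eq s t) :: G₂) := by
  refine fun τ => conjFalse_subst_middle.2 ?_
  by_cases hτ : s.subst τ = t.subst τ
  · obtain ⟨δ, rfl⟩ := hσ.exists_ground_factor hτ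
    exact Or.inr (Conj.subst_subst (G₁ ++ G₂) σ δ ▸ h δ)
  · exact Or.inl hτ

theorem Interp.goalFalse_eq_of_not_unifiable {G₁ G₂ : Conj L ℕ} {s t : L.Term ℕ}
    (h : ∀ σ : ℕ → L.Term ℕ, s.subst σ ≠ t.subst σ) :
    I.GoalFalse (G₁ ++ .pos (.eq s t) :: G₂) := by
  refine fun τ => conjFalse_subst_middle.2 (Or.inl fun hτ : s.subst τ = t.subst τ => ?_)
  refine h (fun x => (τ x).subst Empty.elim) ?_
  rw [← term_subst_subst, ← term_subst_subst, hτ]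

theorem Interp.GoalTrue.insert_neg {G₁ G₂ : Conj L ℕ} {A : Atom L Empty} (hA : I.AtomFalse A)
    (h : I.GoalTrue (G₁ ++ G₂)) : I.GoalTrue (G₁ ++ .neg A.ofGround :: G₂) := by
  obtain ⟨σ, hσ⟩ := h
  refine ⟨σ, conjTrue_subst_middle.2 ⟨?_, hσ⟩⟩
  rwa [Literal.subst, Atom.subst_ofGround]

theorem Interp.GoalFalse.insert {G₁ G₂ : Conj L ℕ} (h : I.GoalFalse (G₁ ++ G₂))
    (l : Literal L ℕ) : I.GoalFalse (G₁ ++ l :: G₂) :=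
  fun σ => conjFalse_subst_middle.2 (Or.inr (h σ))

theorem Interp.goalFalse_neg {G₁ G₂ : Conj L ℕ} {A : Atom L Empty} (hA : I.AtomTrue A) :
    I.GoalFalse (G₁ ++ .neg A.ofGround :: G₂) := by
  refine fun σ => conjFalse_subst_middle.2 (Or.inl ?_)
  rwa [Literal.subst, Atom.subst_ofGround]

end Goals

section Models

variable {L : FirstOrder.Language.{u, v}} {P : Program L} {I : Interp L}

theorem isModel_iff_phi_le : IsModel (fun a b => a ≥ b) P I ↔ P.phi I ≤ I := by
  constructor
  · rintro hI _ b ⟨d, hd, ts, rfl, hb⟩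
    exact hI d hd ts hb
  · exact fun h d hd ts b hb => h ⟨d.pred, ts⟩ ⟨d, hd, ts, rfl, hb⟩

theorem IsModel.lfp_le (hI : IsModel (fun a b => a ≥ b) P I) : OrderHom.lfp P.phi ≤ I :=
  OrderHom.lfp_le P.phi (isModel_iff_phi_le.1 hI)

theorem IsModel.true_mem_of_bodyTrue (hI : IsModel (fun a b => a ≥ b) P I) {d : PredDef L}
    (hd : d ∈ P.defs) {ts : Fin d.pred.1 → L.Term Empty} (h : I.BodyTrue d ts) :
    true ∈ I ⟨d.pred, ts⟩ :=
  hI d hd ts (Or.inl ⟨rfl, h⟩)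

theorem IsModel.false_mem_of_bodyFalse (hI : IsModel (fun a b => a ≥ b) P I) {d : PredDef L}
    (hd : d ∈ P.defs) {ts : Fin d.pred.1 → L.Term Empty} (h : I.BodyFalse d ts) :
    false ∈ I ⟨d.pred, ts⟩ :=
  hI d hd ts (Or.inr ⟨rfl, h⟩)

theorem IsModel.goalTrue_of_resolvent (hI : IsModel (fun a b => a ≥ b) P I) {G₁ G₂ : Conj L ℕ}
    {d : PredDef L} (hd : d ∈ P.defs) {ts : Fin d.pred.1 → L.Term ℕ} {ρ : Fin d.locals → ℕ}
    {C : Conj L (Fin d.pred.1 ⊕ Fin d.locals)} (hC : C ∈ d.disjuncts)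
    (h : I.GoalTrue (G₁ ++ PredDef.resolvent ts ρ C ++ G₂)) :
    I.GoalTrue (G₁ ++ .pos (.rel ⟨d.pred, ts⟩) :: G₂) := by
  obtain ⟨σ, hσ⟩ := h
  obtain ⟨hres, hrest⟩ := Interp.conjTrue_subst_splice.1 hσ
  rw [PredDef.subst_resolvent] at hres
  exact ⟨σ, Interp.conjTrue_subst_middle.2
    ⟨hI.true_mem_of_bodyTrue hd ⟨σ ∘ ρ, C, hC, hres⟩, hrest⟩⟩

theorem IsModel.goalFalse_of_resolvents (hI : IsModel (fun a b => a ≥ b) P I) {G₁ G₂ : Conj L ℕ}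
    {d : PredDef L} (hd : d ∈ P.defs) {ts : Fin d.pred.1 → L.Term ℕ} {ρ : Fin d.locals → ℕ}
    (hρ : Function.Injective ρ)
    (hfresh : ∀ j, ρ j ∉ Conj.vars (G₁ ++ .pos (.rel ⟨d.pred, ts⟩) :: G₂))
    (h : ∀ C ∈ d.disjuncts, I.GoalFalse (G₁ ++ PredDef.resolvent ts ρ C ++ G₂)) :
    I.GoalFalse (G₁ ++ .pos (.rel ⟨d.pred, ts⟩) :: G₂) := by
  refine fun σ => Interp.conjFalse_subst_middle.2 (or_iff_not_imp_right.2 fun hrest => ?_)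
  refine hI.false_mem_of_bodyFalse hd fun w C hC => ?_
  obtain ⟨τ, hτrest, hτres⟩ := PredDef.exists_subst_resolvent_eq hρ hfresh σ w
  have hsplit := Interp.conjFalse_subst_splice.1 (h C hC τ)
  rw [hτrest, hτres] at hsplit
  exact hsplit.resolve_right hrest

mutual

theorem IsModel.goalTrue_of_goalSucceeds [Nonempty (L.Term Empty)]
    (hI : IsModel (fun a b => a ≥ b) P I) {G : Conj L ℕ} : P.GoalSucceeds G → I.GoalTrue G
  | .nil => Interp.goalTrue_nil
  | .rel _ _ _ hd _ _ _ _ _ hC h => hI.goalTrue_of_resolvent hd hC (hI.goalTrue_of_goalSucceeds h)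
  | .eq _ _ _ _ _ hσ h => (hI.goalTrue_of_goalSucceeds h).insert_eq hσ.1
  | .neg _ _ _ hA h =>
    (hI.goalTrue_of_goalSucceeds h).insert_neg
      (Interp.goalFalse_ofGround_iff.1 (hI.goalFalse_of_goalFails hA))

theorem IsModel.goalFalse_of_goalFails [Nonempty (L.Term Empty)]
    (hI : IsModel (fun a b => a ≥ b) P I) {G : Conj L ℕ} : P.GoalFails G → I.GoalFalse G
  | .rel _ _ _ hd _ _ hρ hfresh h =>
    hI.goalFalse_of_resolvents hd hρ hfresh fun C hC => hI.goalFalse_of_goalFails (h C hC)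
  | .eq _ _ _ _ _ hσ h => (hI.goalFalse_of_goalFails h).insert_eq hσ
  | .eq_not_unifiable _ _ _ _ h => Interp.goalFalse_eq_of_not_unifiable h
  | .neg _ _ _ _ h => (hI.goalFalse_of_goalFails h).insert _
  | .neg_of_succeeds _ _ _ hA =>
    Interp.goalFalse_neg (Interp.goalTrue_ofGround_iff.1 (hI.goalTrue_of_goalSucceeds hA))

end

theorem IsModel.true_mem_of_succeeds [Nonempty (L.Term Empty)]
    (hI : IsModel (fun a b => a ≥ b) P I) {A : GroundAtom L} (hA : P.Succeeds A) : true ∈ I A :=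
  Interp.goalTrue_ofGround_iff.1 (hI.goalTrue_of_goalSucceeds hA)

theorem IsModel.true_mem_of_ideallySucceeds (hI : IsModel (fun a b => a ≥ b) P I)
    {A : GroundAtom L} (hA : P.IdeallySucceeds A) : true ∈ I A :=
  have hlfp : true ∈ OrderHom.lfp P.phi A := Set.ext_iff.1 hA true |>.2 rfl
  hI.lfp_le A hlfp

end Models

section Modes

variable {L : FirstOrder.Language.{u, v}} {error : L.Relations 1} {T : Typing L}

theorem true_mem_modeValue_iff {p : Pred L} {m : Mode p} {ts : Fin p.1 → L.Term Empty} :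
    true ∈ modeValue error T p m ts ↔
      p ≠ ⟨1, error⟩ ∧ ((∀ i, T p ts i) ∨ ∃ i, m i = Direction.input ∧ ¬ T p ts i) := by
  unfold modeValue
  split_ifs <;> simp_all [Four.u, Four.t, Four.i, Four.f]

theorem ModedProgram.modeInterp_le_modeValue {Q : ModedProgram L} {A : GroundAtom L}
    {m : Mode A.pred} (hm : m ∈ Q.modes A.pred) :
    Q.modeInterp error T A ≤ modeValue error T A.pred m A.args :=
  iInf₂_le m hm

end Modes

end LogicProg

theorem mainTheorem7 {L : FirstOrder.Language.{u, v}} (error : L.Relations 1)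
    (T : LogicProg.Typing L) (Q : LogicProg.ModedProgram L)
    (hM : LogicProg.IsModel (fun a b => a ≥ b) Q.program (Q.modeInterp error T))
    (A : LogicProg.GroundAtom L)
    (hA : Q.program.Succeeds A ∨ Q.program.IdeallySucceeds A)
    (hin : ∃ m ∈ Q.modes A.pred,
      ∀ i, m i = LogicProg.Direction.input → T A.pred A.args i) :
    ∀ i, T A.pred A.args i := by
  intro j
  have : Nonempty (L.Term Empty) := ⟨A.args j⟩
  obtain ⟨m, hm, hinputs⟩ := hin
  have htrue : true ∈ Q.modeInterp error T A :=
    hA.elim hM.true_mem_of_succeeds hM.true_mem_of_ideallySucceeds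
  have htrue_mode : true ∈ LogicProg.modeValue error T A.pred m A.args :=
    LogicProg.ModedProgram.modeInterp_le_modeValue hm htrue
  rcases (LogicProg.true_mem_modeValue_iff.1 htrue_mode).2 with hall | ⟨i, hi, hill⟩
  · exact hall j
  · exact absurd (hinputs i hi) hill
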